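/- Let $\mathcal S,\mathcal A,\mathcal E$ be finite sets (states, actions, events) with $\mathcal A\neq\emptyset$, let $d\in\mathbb N$, and let a Lexicographic Markov Decision Process (LMDP) be given by - for each $(s,a)\in\mathcal S\times\mathcal A$, a probability distribution $\mathbb P(\cdot\mid s,a)$ on $\mathcal S\times\mathcal E$ (next state and event); - rewards $r:\mathcal E\to\mathbb R^d$; - reward multipliers $\Gamma:\mathcal E\to \mathrm{LTP}_d\cup\{\mathbf 0\}$, where $\mathrm{LTP}_d$ is the set of real lower triangular $d\times d$ matrices with positive diagonal entries. Assume that $\Gamma_{i,i}(e)<1$ for all $e\in\mathcal E$ and $1\le i\le d$. Vectors of $\mathbb R^d$ are compared lexicographically, the first entry having the highest priority. A policy $\pi$ may be randomized and may depend on the whole history of states, actions and events; it is stationary deterministic if it is given by a function $f:\mathcal S\to\mathcal A$, the action $f(s)$ being taken whenever the current state is $s$. The return of a trajectory $s_0,a_0,e_0,s_1,a_1,e_1,\dots$ is $$G=\sum_{t=0}^\infty \Gamma(e_0)\Gamma(e_1)\cdots\Gamma(e_{t-1})\,r(e_t),$$ and $V^\pi(s)=\mathbb E_\pi[G\mid s_0=s]$,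 $Q^\pi(s,a)=\mathbb E_\pi[G\mid s_0=s,a_0=a]$. Then the series defining $G$ converges absolutely for every sequence of events, and $G$ is integrable under every policy, from every $s$ and from every $(s,a)$. The lexicographic maximum $Q^\star(s,a)=\operatorname{lexmax}_\pi Q^\pi(s,a)$ over all policies exists for all $(s,a)$, and: 1. There exists a stationary deterministic policy $\pi$ that is uniformly optimal, i.e. $Q^\pi=Q^\star$; it can be chosen such that, moreover, $V^{\pi'}(s)\le_{\mathrm{lex}}V^\pi(s)$ for all policies $\pi'$ and all starting states $s$. 2. Every stationary deterministic policy $\pi:\mathcal S\to\mathcal A$ with $\pi(s)\in\operatorname{lexargmax}_{a}Q^\star(s,a)$ for all $s\in\mathcal S$ has both of these properties. -/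

import Mathlib

open MeasureTheory ProbabilityTheory

/-- `LTP d`: real lower triangular `d × d` matrices with positive diagonal entries. -/
def LTP (d : ℕ) : Set (Matrix (Fin d) (Fin d) ℝ) :=
  {G | (∀ i j, i < j → G i j = 0) ∧ ∀ i, 0 < G i i}

/-- A lexicographic Markov decision process with state set `S`, action set `A`, event set `E`
and `d`-dimensional rewards. -/
structure LMDP (S A E : Type*) (d : ℕ) where
  /-- joint law of the next state and the emitted event, given the current state and action -/
  trans : S → A → PMF (S × E)
  /-- reward vector of an event -/
  reward : E → Fin d → ℝ
  /-- matrix reward multiplier of an event (zero for terminal events) -/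
  mult : E → Matrix (Fin d) (Fin d) ℝ
  mult_mem : ∀ e, mult e ∈ LTP d ∪ {0}

/-- One step of the interaction: the action taken, the event observed, the state reached. -/
@[ext]
structure Step (S A E : Type*) where
  action : A
  event : E
  next : S

namespace Step

variable {S A E : Type*}

/-- Steps carry the discrete σ-algebra. -/
instance : MeasurableSpace (Step S A E) := ⊤

instance : DiscreteMeasurableSpace (Step S A E) := ⟨fun _ => trivial⟩

instance [Finite S] [Finite A] [Finite E] : Finite (Step S A E) :=
  Finite.of_injective (fun x : Step S A E => (x.action, x.event, x.next)) (by
    intro x y h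
    simp only [Prod.mk.injEq] at h
    exact Step.ext h.1 h.2.1 h.2.2)

end Step

/-- The current state after the initial state `s₀` and the steps `h 0, …, h (n - 1)`. -/
def currentState {S A E : Type*} (s₀ : S) : {n : ℕ} → (Fin n → Step S A E) → S
  | 0, _ => s₀
  | n + 1, h => (h (Fin.last n)).next

/-- A general policy, history-dependent and randomized: at each time `n` it maps the initial
state and the first `n` steps to a distribution over actions. -/
def Policy (S A E : Type*) := (n : ℕ) → S → (Fin n → Step S A E) → PMF A

/-- The stationary deterministic policy that takes action `f s` whenever the state is `s`. -/
noncomputable def Policy.stationary {S A : Type*} (E : Type*) (f : S → A) : Policy S A E :=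
  fun _ s₀ h => PMF.pure (f (currentState s₀ h))

/-- The lexicographic argmax over `a` of the vectors `q a`. -/
def lexArgmax {A : Type*} {d : ℕ} (q : A → Fin d → ℝ) : Set A :=
  {a | ∀ b, toLex (q b) ≤ toLex (q a)}

namespace LMDP

variable {S A E : Type*} {d : ℕ} (M : LMDP S A E d)

/-- Every diagonal entry of every reward multiplier is less than one. -/
def DiagonalDiscount : Prop := ∀ e i, M.mult e i i < 1

/-- The product `Γ(e₀) Γ(e₁) ⋯ Γ(eₜ₋₁)`. -/
def discount (e : ℕ → E) : ℕ → Matrix (Fin d) (Fin d) ℝ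
  | 0 => 1
  | t + 1 => discount e t * M.mult (e t)

/-- The contribution `Γ(e₀) ⋯ Γ(eₜ₋₁) r(eₜ)` of time `t` to the return. -/
def discountedReward (e : ℕ → E) (t : ℕ) : Fin d → ℝ :=
  (M.discount e t).mulVec (M.reward (e t))

/-- The return `r(e₀) + Γ(e₀) r(e₁) + Γ(e₀) Γ(e₁) r(e₂) + ⋯` of a sequence of events. -/
noncomputable def eventReturn (e : ℕ → E) : Fin d → ℝ := ∑' t, M.discountedReward e t

/-- The return of a trajectory. -/
noncomputable def trajReturn (ω : ℕ → Step S A E) : Fin d → ℝ :=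
  M.eventReturn fun t => (ω t).event

/-- The law of the step from state `s` when taking action `a`. -/
noncomputable def stepLaw (s : S) (a : A) : PMF (Step S A E) :=
  (M.trans s a).map fun x => ⟨a, x.2, x.1⟩

/-- The law of the next step after a history `h`, when the action is drawn from `π`. -/
noncomputable def policyStep (π : Policy S A E) (s₀ : S) {n : ℕ} (h : Fin n → Step S A E) :
    PMF (Step S A E) :=
  (π n s₀ h).bind fun a => M.stepLaw (currentState s₀ h) a

variable [Finite S] [Finite A] [Finite E]

/-- The transition kernel of the interaction of `π` with the process, from the steps
`0, …, n` to step `n + 1`. -/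
noncomputable def stepKernel (π : Policy S A E) (s₀ : S) (n : ℕ) :
    Kernel ((i : Finset.Iic n) → Step S A E) (Step S A E) :=
  Kernel.ofFunOfCountable fun x =>
    (M.policyStep π s₀ fun i : Fin (n + 1) =>
      x ⟨i, Finset.mem_Iic.2 (Nat.lt_succ_iff.1 i.2)⟩).toMeasure

instance (π : Policy S A E) (s₀ : S) (n : ℕ) : IsMarkovKernel (M.stepKernel π s₀ n) :=
  ⟨fun _ => PMF.toMeasure.isProbabilityMeasure _⟩

/-- The law of the infinite trajectory from state `s₀`, when step `0` has law `μ` and the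
later actions are drawn from `π`. -/
noncomputable def trajLaw (π : Policy S A E) (s₀ : S) (μ : PMF (Step S A E)) :
    Measure (ℕ → Step S A E) :=
  Kernel.trajMeasure (X := fun _ => Step S A E) μ.toMeasure (M.stepKernel π s₀)

/-- The trajectory law given `s₀ = s` and `a₀ = a`, following `π` thereafter. -/
noncomputable def lawQ (π : Policy S A E) (s : S) (a : A) : Measure (ℕ → Step S A E) :=
  M.trajLaw π s (M.stepLaw s a)

/-- The trajectory law given `s₀ = s`, following `π`. -/
noncomputable def lawV (π : Policy S A E) (s : S) : Measure (ℕ → Step S A E) :=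
  M.trajLaw π s (M.policyStep π s Fin.elim0)

/-- The `Q`-value function of a policy. -/
noncomputable def qValue (π : Policy S A E) (s : S) (a : A) : Fin d → ℝ :=
  ∫ ω, M.trajReturn ω ∂M.lawQ π s a

/-- The value function of a policy. -/
noncomputable def value (π : Policy S A E) (s : S) : Fin d → ℝ :=
  ∫ ω, M.trajReturn ω ∂M.lawV π s

/-- `q` is the optimal `Q`-value function: `q s a` is the lexicographic maximum, over all
policies `π`, of the `Q`-values of `π` at `(s, a)`. -/
def IsOptimalQ (q : S → A → Fin d → ℝ) : Prop :=
  ∀ s a, IsGreatest (Set.range fun π : Policy S A E => toLex (M.qValue π s a)) (toLex (q s a))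

/-- `π` is optimal, among all policies, from every starting state. -/
def IsOptimalFromEveryState (π : Policy S A E) : Prop :=
  ∀ (π' : Policy S A E) (s : S), toLex (M.value π' s) ≤ toLex (M.value π s)

/-- `π` is uniformly optimal: its `Q`-value function is the optimal `Q`-value function. -/
def IsUniformlyOptimal (π : Policy S A E) : Prop := M.IsOptimalQ (M.qValue π)

end LMDP

/-! The lexicographically nonnegative vectors form a convex cone preserved by the multipliers. The
cone is not closed: $(1/n,-1)\to(0,-1)$, so inequalities cannot be passed to limits, as value
iteration would do. They do survive convergent series and integrals of elements of the cone, since a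
vanishing sum of nonnegative numbers has only vanishing terms (`LexNonneg.of_hasSum`,
`LexNonneg.integral`).

The performance difference lemma (`hasSum_value_sub`) writes $V^\pi-V$ as exactly such a series:
expected discounted one-step advantages of $\pi$ over an arbitrary $V$. If no action improves on
$V$, every policy has value at most $V$; if the action of $f$ never loses against $V$, the
stationary policy of $f$ has value at least $V$. Convergence comes from a weighted supremum norm in
which all multipliers contract uniformly (`exists_contraction_weights`).

It remains to solve the Bellman equation. There are finitely many stationary deterministic policies,
so one has a maximal value function; greedy improvement cannot increase it, so it satisfies the
optimality equation (`exists_bellman_optimal`). Then $Q^\star$ is its one-step lookahead. -/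

/-! ### The cone of lexicographically nonnegative vectors -/

/-- Nonnegativity of a real vector in the lexicographic order, the first entry having the highest
priority. -/
def LexNonneg {d : ℕ} (x : Fin d → ℝ) : Prop := ∀ i, (∀ j < i, x j = 0) → 0 ≤ x i

theorem toLex_le_toLex_iff_lexNonneg {d : ℕ} {x y : Fin d → ℝ} :
    toLex x ≤ toLex y ↔ LexNonneg (y - x) := by
  refine ⟨fun h i hi => ?_, fun h => ?_⟩
  · exact sub_nonneg.2 (Pi.apply_le_of_toLex h fun j hj => (sub_eq_zero.1 (hi j hj)).symm)
  · by_contra hlt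
    obtain ⟨i, hi, hlt⟩ := not_le.1 hlt
    have := h i fun j hj => sub_eq_zero.2 (hi j hj)
    exact absurd (sub_nonneg.1 this) (not_le.2 hlt)

namespace LexNonneg

variable {d : ℕ}

theorem zero : LexNonneg (0 : Fin d → ℝ) := fun _ _ => le_rfl

theorem smul {x : Fin d → ℝ} (hx : LexNonneg x) {c : ℝ} (hc : 0 ≤ c) : LexNonneg (c • x) := by
  rcases hc.eq_or_lt with rfl | hc
  · simpa using zero
  · intro i hi
    refine mul_nonneg hc.le (hx i fun j hj => ?_)
    simpa [hc.ne'] using hi j hj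

/-- A convergent series of lexicographically nonnegative vectors has a lexicographically
nonnegative sum. -/
theorem of_hasSum {ι : Type*} {f : ι → Fin d → ℝ} {x : Fin d → ℝ} (hf : HasSum f x)
    (h : ∀ n, LexNonneg (f n)) : LexNonneg x := by
  have hc : ∀ i, HasSum (fun n => f n i) (x i) := Pi.hasSum.1 hf
  intro i hi
  -- Priority by priority: once all earlier coordinates vanish in every term, the terms are
  -- nonnegative at `j`, and their zero sum makes each of them zero.
  have hzero : ∀ j, j < i → ∀ n, f n j = 0 := by
    intro j
    induction j using WellFoundedLT.induction with
    | _ j ih =>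
      intro hj
      have hnonneg : ∀ n, 0 ≤ f n j := fun n => h n j fun k hk => ih k hk (hk.trans hj) n
      exact fun n => congrFun ((hasSum_zero_iff_of_nonneg hnonneg).1 (hi j hj ▸ hc j)) n
  exact (hc i).nonneg fun n => h n i fun j hj => hzero j hj n

theorem sum {ι : Type*} [Fintype ι] {f : ι → Fin d → ℝ} (h : ∀ n, LexNonneg (f n)) :
    LexNonneg (∑ n, f n) :=
  of_hasSum (hasSum_fintype f) h

/-- The integral of lexicographically nonnegative vectors is lexicographically nonnegative. -/
theorem integral {Ω : Type*} [MeasurableSpace Ω] {μ : Measure Ω} {X : Ω → Fin d → ℝ}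
    (hX : Integrable X μ) (h : ∀ ω, LexNonneg (X ω)) : LexNonneg (∫ ω, X ω ∂μ) := by
  have hint : ∀ i, Integrable (fun ω => X ω i) μ := fun i => hX.eval i
  have hc : ∀ i, (∫ ω, X ω ∂μ) i = ∫ ω, X ω i ∂μ := eval_integral hint
  intro i hi
  have hprefix : ∀ j, j ≤ i → (∀ k < j, ∀ᵐ ω ∂μ, X ω k = 0) → ∀ᵐ ω ∂μ, 0 ≤ X ω j := by
    intro j _ hk
    have : ∀ᵐ ω ∂μ, ∀ k : Fin d, k < j → X ω k = 0 := by
      rw [ae_all_iff]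
      intro k
      by_cases hkj : k < j
      · filter_upwards [hk k hkj] with ω hω using fun _ => hω
      · exact ae_of_all _ fun ω hlt => absurd hlt hkj
    filter_upwards [this] with ω hω using h ω j hω
  have hzero : ∀ j, j < i → ∀ᵐ ω ∂μ, X ω j = 0 := by
    intro j
    induction j using WellFoundedLT.induction with
    | _ j ih =>
      intro hj
      have hnonneg := hprefix j hj.le fun k hk => ih k hk (hk.trans hj)
      exact (integral_eq_zero_iff_of_nonneg_ae hnonneg (hint j)).1 ((hc j).symm.trans (hi j hj))
  rw [hc]
  exact integral_nonneg_of_ae (hprefix i le_rfl hzero)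

/-- Lower triangular matrices with positive diagonal preserve lexicographic nonnegativity. -/
theorem mulVec {G : Matrix (Fin d) (Fin d) ℝ} (hG : G ∈ LTP d ∪ {0}) {x : Fin d → ℝ}
    (hx : LexNonneg x) : LexNonneg (G.mulVec x) := by
  rcases hG with ⟨hlow, hdiag⟩ | rfl
  -- Entries above the diagonal are zero and those below it meet only zero coordinates of `x`, so
  -- the diagonal term alone is left.
  · have key : ∀ i, (∀ j < i, x j = 0) → G.mulVec x i = G i i * x i := by
      intro i hi
      refine Finset.sum_eq_single i (fun j _ hj => ?_)
        fun h => absurd (Finset.mem_univ i) h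
      rcases lt_or_gt_of_ne hj with hlt | hlt
      · rw [hi j hlt, mul_zero]
      · exact mul_eq_zero_of_left (hlow i j hlt) _
    intro i hi
    have hzero : ∀ j, j < i → x j = 0 := by
      intro j
      induction j using WellFoundedLT.induction with
      | _ j ih =>
        intro hj
        have := (key j fun k hk => ih k hk (hk.trans hj)).symm.trans (hi j hj)
        exact (mul_eq_zero.1 this).resolve_left (hdiag j).ne'
    rw [key i hzero]
    exact mul_nonneg (hdiag i).le (hx i hzero)
  · simpa using zero

end LexNonneg

/-! ### Contraction in a weighted norm and convergence of the return -/

namespace LMDP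

variable {S A E : Type*} {d : ℕ} (M : LMDP S A E d)

theorem mult_apply_of_lt (e : E) {i j : Fin d} (h : i < j) : M.mult e i j = 0 := by
  rcases M.mult_mem e with hG | hG
  · exact hG.1 i j h
  · rw [Set.mem_singleton_iff.1 hG, Matrix.zero_apply]

theorem mult_diag_nonneg (e : E) (i : Fin d) : 0 ≤ M.mult e i i := by
  rcases M.mult_mem e with hG | hG
  · exact (hG.2 i).le
  · rw [Set.mem_singleton_iff.1 hG, Matrix.zero_apply]

/-- The reward multipliers are uniformly contracting in a suitably weighted supremum norm. -/
theorem exists_contraction_weights [Finite E] (hM : M.DiagonalDiscount) :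
    ∃ (w : Fin d → ℝ) (ρ : ℝ), (∀ i, 1 ≤ w i) ∧ 0 ≤ ρ ∧ ρ < 1 ∧
      ∀ e i, ∑ j, |M.mult e i j| * w j ≤ ρ * w i := by
  obtain ⟨γ, hγ0, hγ1, hγ⟩ : ∃ γ : ℝ, 0 ≤ γ ∧ γ < 1 ∧ ∀ x : E × Fin d, M.mult x.1 x.2 x.2 ≤ γ := by
    have h1 : ∀ᶠ γ in nhdsWithin (1 : ℝ) (Set.Iio 1), ∀ x : E × Fin d, M.mult x.1 x.2 x.2 ≤ γ :=
      Filter.eventually_all.2 fun x =>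
        nhdsWithin_le_nhds ((lt_mem_nhds (hM x.1 x.2)).mono fun _ h => le_of_lt h)
    have h2 : ∀ᶠ γ in nhdsWithin (1 : ℝ) (Set.Iio 1), 0 ≤ γ :=
      nhdsWithin_le_nhds ((lt_mem_nhds one_pos).mono fun _ h => le_of_lt h)
    obtain ⟨γ, h, h0, h1⟩ := (h1.and (h2.and self_mem_nhdsWithin)).exists
    exact ⟨γ, h0, h1, h⟩
  -- With this `ε`, `γ + d * ε = 1 - ε < 1`: each of the `d` entries of a row may cost an extra `ε`.
  set ε : ℝ := (1 - γ) / (d + 1) with hε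
  have hd : (0 : ℝ) < d + 1 := by positivity
  have hε0 : 0 < ε := div_pos (sub_pos.2 hγ1) hd
  have hεd : (d + 1) * ε = 1 - γ := mul_div_cancel₀ _ hd.ne'
  -- With weights `K ^ i`, an entry below the diagonal is damped by at least one factor `K`, which
  -- absorbs its size down to `ε`.
  obtain ⟨K, hK1, hK⟩ : ∃ K : ℝ, 1 ≤ K ∧
      ∀ x : E × Fin d × Fin d, |M.mult x.1 x.2.1 x.2.2| / ε ≤ K :=
    ((Filter.eventually_ge_atTop 1).and
      (Filter.eventually_all.2 fun _ => Filter.eventually_ge_atTop _)).exists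
  refine ⟨fun i => K ^ (i : ℕ), γ + d * ε, fun i => one_le_pow₀ hK1, by positivity,
    by linarith, fun e i => ?_⟩
  have hterm : ∀ j, |M.mult e i j| * K ^ (j : ℕ) ≤
      (if j = i then γ * K ^ (i : ℕ) else 0) + ε * K ^ (i : ℕ) := by
    intro j
    have hpos : 0 ≤ ε * K ^ (i : ℕ) := by positivity
    rcases lt_trichotomy j i with hlt | rfl | hlt
    · rw [if_neg hlt.ne, zero_add]
      calc |M.mult e i j| * K ^ (j : ℕ) ≤ (K * ε) * K ^ (j : ℕ) := by
            gcongr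
            exact (div_le_iff₀ hε0).1 (hK (e, i, j))
        _ = ε * K ^ ((j : ℕ) + 1) := by ring
        _ ≤ ε * K ^ (i : ℕ) := by
            gcongr
            exact hlt
    · rw [if_pos rfl, abs_of_nonneg (M.mult_diag_nonneg e j)]
      have := mul_le_mul_of_nonneg_right (hγ (e, j)) (by positivity : 0 ≤ K ^ (j : ℕ))
      simp only at this
      linarith
    · rw [if_neg hlt.ne', M.mult_apply_of_lt e hlt, abs_zero, zero_mul, zero_add]
      exact hpos
  calc ∑ j, |M.mult e i j| * K ^ (j : ℕ)
      ≤ ∑ j, ((if j = i then γ * K ^ (i : ℕ) else 0) + ε * K ^ (i : ℕ)) :=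
        Finset.sum_le_sum fun j _ => hterm j
    _ = (γ + d * ε) * K ^ (i : ℕ) := by
        rw [Finset.sum_add_distrib, Finset.sum_ite_eq' Finset.univ i, if_pos (Finset.mem_univ i),
          Finset.sum_const, Finset.card_univ, Fintype.card_fin, nsmul_eq_mul]
        ring

theorem sum_abs_discount_mul_le {w : Fin d → ℝ} {ρ : ℝ} (hw : ∀ i, 0 ≤ w i) (hρ : 0 ≤ ρ)
    (h : ∀ e i, ∑ j, |M.mult e i j| * w j ≤ ρ * w i) (e : ℕ → E) (t : ℕ) (i : Fin d) :
    ∑ j, |M.discount e t i j| * w j ≤ ρ ^ t * w i := by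
  induction t with
  | zero => simp [discount, Matrix.one_apply, apply_ite abs, ite_mul]
  | succ t ih =>
    calc ∑ k, |M.discount e (t + 1) i k| * w k
        ≤ ∑ k, ∑ j, |M.discount e t i j| * (|M.mult (e t) j k| * w k) := by
          refine Finset.sum_le_sum fun k _ => ?_
          rw [discount, Matrix.mul_apply]
          refine (mul_le_mul_of_nonneg_right (Finset.abs_sum_le_sum_abs _ _) (hw k)).trans_eq ?_
          simp only [Finset.sum_mul, abs_mul, mul_assoc]
      _ = ∑ j, |M.discount e t i j| * ∑ k, |M.mult (e t) j k| * w k := by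
          rw [Finset.sum_comm]
          simp only [Finset.mul_sum]
      _ ≤ ∑ j, |M.discount e t i j| * (ρ * w j) :=
          Finset.sum_le_sum fun j _ => mul_le_mul_of_nonneg_left (h _ _) (abs_nonneg _)
      _ = ρ * ∑ j, |M.discount e t i j| * w j := by
          rw [Finset.mul_sum]
          exact Finset.sum_congr rfl fun j _ => by ring
      _ ≤ ρ * (ρ ^ t * w i) := mul_le_mul_of_nonneg_left ih hρ
      _ = ρ ^ (t + 1) * w i := by ring

theorem abs_mulVec_le_of_sum_abs_le {w x : Fin d → ℝ} {G : Matrix (Fin d) (Fin d) ℝ} {R c : ℝ}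
    {i : Fin d} (hR : 0 ≤ R) (hx : ∀ j, |x j| ≤ R * w j) (hG : ∑ j, |G i j| * w j ≤ c) :
    |G.mulVec x i| ≤ R * c := by
  calc |G.mulVec x i| ≤ ∑ j, |G i j * x j| :=
        Finset.abs_sum_le_sum_abs (fun j => G i j * x j) Finset.univ
    _ ≤ ∑ j, R * (|G i j| * w j) := Finset.sum_le_sum fun j _ => by
        rw [abs_mul, mul_left_comm]
        exact mul_le_mul_of_nonneg_left (hx j) (abs_nonneg _)
    _ = R * ∑ j, |G i j| * w j := by rw [Finset.mul_sum]
    _ ≤ R * c := mul_le_mul_of_nonneg_left hG hR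

/-- The discount products decay geometrically, uniformly in the sequence of events. -/
theorem exists_norm_discount_mulVec_le [Finite E] (hM : M.DiagonalDiscount) :
    ∃ C ρ : ℝ, 0 ≤ C ∧ 0 ≤ ρ ∧ ρ < 1 ∧
      ∀ e t x, ‖(M.discount e t).mulVec x‖ ≤ C * ‖x‖ * ρ ^ t := by
  obtain ⟨w, ρ, hw, hρ0, hρ1, h⟩ := M.exists_contraction_weights hM
  have hw0 : ∀ i, 0 ≤ w i := fun i => zero_le_one.trans (hw i)
  refine ⟨∑ i, w i, ρ, Finset.sum_nonneg fun i _ => hw0 i, hρ0, hρ1, fun e t x => ?_⟩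
  have hC : 0 ≤ ∑ i, w i := Finset.sum_nonneg fun i _ => hw0 i
  refine (pi_norm_le_iff_of_nonneg (by positivity)).2 fun i => ?_
  have hx : ∀ j, |x j| ≤ ‖x‖ * w j := fun j =>
    (norm_le_pi_norm x j).trans (le_mul_of_one_le_right (norm_nonneg x) (hw j))
  calc |(M.discount e t).mulVec x i|
      ≤ ‖x‖ * (ρ ^ t * w i) :=
        abs_mulVec_le_of_sum_abs_le (norm_nonneg x) hx (M.sum_abs_discount_mul_le hw0 hρ0 h e t i)
    _ ≤ ‖x‖ * (ρ ^ t * ∑ i, w i) := by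
        gcongr
        exact Finset.single_le_sum (f := w) (fun j _ => hw0 j) (Finset.mem_univ i)
    _ = (∑ i, w i) * ‖x‖ * ρ ^ t := by ring

/-- The discounted rewards are dominated by a geometric series, uniformly in the sequence of
events. -/
theorem exists_norm_discountedReward_le [Finite E] (hM : M.DiagonalDiscount) :
    ∃ C ρ : ℝ, 0 ≤ ρ ∧ ρ < 1 ∧ ∀ e t, ‖M.discountedReward e t‖ ≤ C * ρ ^ t := by
  obtain ⟨C, ρ, hC, hρ0, hρ1, h⟩ := M.exists_norm_discount_mulVec_le hM
  obtain ⟨R, hR⟩ : ∃ R, ∀ e, ‖M.reward e‖ ≤ R :=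
    (Filter.eventually_all.2 fun e => Filter.eventually_ge_atTop ‖M.reward e‖).exists
  refine ⟨C * R, ρ, hρ0, hρ1, fun e t => (h e t _).trans ?_⟩
  gcongr
  exact hR _

theorem summable_discountedReward [Finite E] (hM : M.DiagonalDiscount) (e : ℕ → E) :
    Summable (M.discountedReward e) := by
  obtain ⟨C, ρ, hρ0, hρ1, h⟩ := M.exists_norm_discountedReward_le hM
  exact Summable.of_norm_bounded ((summable_geometric_of_lt_one hρ0 hρ1).mul_left C) (h e)

end LMDP

/-! ### Finite histories and the trajectory law -/

theorem MeasureTheory.integrable_comp_of_finite {Ω α F : Type*} [MeasurableSpace Ω]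
    [MeasurableSpace α] [Finite α] [MeasurableSingletonClass α] [NormedAddCommGroup F]
    {μ : Measure Ω} [IsFiniteMeasure μ] (f : α → F) {g : Ω → α} (hg : Measurable g) :
    Integrable (fun ω => f (g ω)) μ :=
  Integrable.comp_measurable (f := g) (g := f) Integrable.of_finite hg

theorem PMF.integral_bind_eq_sum {α β F : Type*} [Fintype α] [Finite β] [MeasurableSpace β]
    [MeasurableSingletonClass β] [NormedAddCommGroup F] [NormedSpace ℝ F] [CompleteSpace F]
    (p : PMF α) (q : α → PMF β) (f : β → F) :
    ∫ x, f x ∂(p.bind q).toMeasure = ∑ a, (p a).toReal • ∫ x, f x ∂(q a).toMeasure := by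
  have := Fintype.ofFinite β
  simp only [PMF.integral_eq_sum, Finset.smul_sum]
  rw [Finset.sum_comm]
  refine Finset.sum_congr rfl fun x _ => ?_
  rw [PMF.bind_apply, tsum_fintype, ENNReal.toReal_sum fun a _ =>
    ENNReal.mul_ne_top (PMF.apply_ne_top _ _) (PMF.apply_ne_top _ _), Finset.sum_smul]
  exact Finset.sum_congr rfl fun a _ => by rw [ENNReal.toReal_mul, mul_smul]

theorem PMF.sum_toReal {α : Type*} [Fintype α] (p : PMF α) : ∑ a, (p a).toReal = 1 := by
  rw [← ENNReal.toReal_sum fun a _ => p.apply_ne_top a, ← tsum_fintype (L := .unconditional α), p.tsum_coe,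
    ENNReal.toReal_one]

/-- The first `n` steps of a trajectory. -/
def history {S A E : Type*} (n : ℕ) (ω : ℕ → Step S A E) : Fin n → Step S A E := fun i => ω i

theorem measurable_history {S A E : Type*} (n : ℕ) :
    Measurable (history n : (ℕ → Step S A E) → Fin n → Step S A E) :=
  measurable_pi_lambda _ fun i => measurable_pi_apply (i : ℕ)

/-- The policy that takes the action `a` at time `0` and follows `π` afterwards. -/
noncomputable def Policy.withFirst {S A E : Type*} (π : Policy S A E) (a : A) : Policy S A E
  | 0, _, _ => PMF.pure a
  | n + 1, s, h => π (n + 1) s h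

namespace LMDP

variable {S A E : Type*} {d : ℕ} (M : LMDP S A E d)

/-- The product of the reward multipliers of the events of a finite history. -/
def historyDiscount : {n : ℕ} → (Fin n → Step S A E) → Matrix (Fin d) (Fin d) ℝ
  | 0, _ => 1
  | n + 1, h => historyDiscount (n := n) (fun i => h i.castSucc) * M.mult (h (Fin.last n)).event

/-- Viewing the discount as a function on the finite type of histories makes its measurability and
integrability automatic. -/
theorem historyDiscount_history (n : ℕ) (ω : ℕ → Step S A E) :
    M.historyDiscount (history n ω) = M.discount (fun t => (ω t).event) n := by
  induction n with
  | zero => rfl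
  | succ n ih => exact congrArg (· * M.mult (ω n).event) ih

theorem currentState_history_succ (s : S) (n : ℕ) (ω : ℕ → Step S A E) :
    currentState s (history (n + 1) ω) = (ω n).next := rfl

theorem _root_.LexNonneg.historyDiscount_mulVec {n : ℕ} {x : Fin d → ℝ} (hx : LexNonneg x)
    (h : Fin n → Step S A E) : LexNonneg ((M.historyDiscount h).mulVec x) := by
  induction n generalizing x with
  | zero => simpa [historyDiscount] using hx
  | succ n ih =>
    rw [historyDiscount, ← Matrix.mulVec_mulVec]
    exact ih (hx.mulVec (M.mult_mem _)) _

theorem policyStep_withFirst (π : Policy S A E) (s : S) (a : A) (h : Fin 0 → Step S A E) :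
    M.policyStep (π.withFirst a) s h = M.stepLaw s a :=
  PMF.pure_bind _ _

theorem policyStep_stationary (f : S → A) (s : S) {n : ℕ} (h : Fin n → Step S A E) :
    M.policyStep (Policy.stationary E f) s h =
      M.stepLaw (currentState s h) (f (currentState s h)) :=
  PMF.pure_bind _ _

variable [Finite S] [Finite A] [Finite E]

instance (π : Policy S A E) (s : S) : IsProbabilityMeasure (M.lawV π s) := by
  unfold lawV trajLaw
  infer_instance

/-- Changing the policy at time 0 leaves all later kernels unchanged, so statements about $Q$ reduce
to statements about $V$. -/
theorem lawQ_eq_lawV_withFirst (π : Policy S A E) (s : S) (a : A) :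
    M.lawQ π s a = M.lawV (π.withFirst a) s := by
  rw [lawQ, lawV, policyStep_withFirst]
  rfl

theorem map_zero_lawV (π : Policy S A E) (s : S) :
    (M.lawV π s).map (fun ω => ω 0) = (M.policyStep π s Fin.elim0).toMeasure := by
  have h1 : (M.lawV π s).map (Preorder.frestrictLe 0) =
      (M.policyStep π s Fin.elim0).toMeasure.map
        (MeasurableEquiv.piUnique fun _ : Finset.Iic 0 => Step S A E).symm := by
    rw [lawV, trajLaw, Kernel.trajMeasure, Measure.map_comp _ _ (by fun_prop),
      Kernel.traj_map_frestrictLe, Kernel.partialTraj_self]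
    exact Measure.id_comp
  have h2 := congrArg (Measure.map fun x : Finset.Iic 0 → Step S A E => x default) h1
  rw [Measure.map_map (by fun_prop) (by fun_prop), Measure.map_map (by fun_prop) (by fun_prop)]
    at h2
  exact h2.trans Measure.map_id

/-- Conditionally on the first `n` steps, step `n` is distributed according to the policy. -/
theorem integral_lawV_step {F : Type*} [NormedAddCommGroup F] [NormedSpace ℝ F] [CompleteSpace F]
    (π : Policy S A E) (s : S) (n : ℕ) (f : (Fin n → Step S A E) → Step S A E → F) :
    ∫ ω, f (history n ω) (ω n) ∂M.lawV π s =
      ∫ ω, ∫ x, f (history n ω) x ∂(M.policyStep π s (history n ω)).toMeasure ∂M.lawV π s := by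
  cases n with
  -- Step 0 is drawn from the initial law and not from a kernel, hence the separate case.
  | zero =>
    have h0 : ∀ ω : ℕ → Step S A E, history 0 ω = Fin.elim0 := fun _ => Subsingleton.elim _ _
    simp only [h0, integral_const, probReal_univ, one_smul]
    rw [← map_zero_lawV, integral_map (measurable_pi_apply 0).aemeasurable Integrable.of_finite.1]
  | succ n =>
    let e : (Finset.Iic n → Step S A E) → Fin (n + 1) → Step S A E := fun x i =>
      x ⟨i, Finset.mem_Iic.2 (Nat.lt_succ_iff.1 i.2)⟩
    let g : (Finset.Iic n → Step S A E) × Step S A E → F := fun p => f (e p.1) p.2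
    have hmap : (M.lawV π s).map (Preorder.frestrictLe n) ⊗ₘ M.stepKernel π s n =
        (M.lawV π s).map fun ω => (Preorder.frestrictLe n ω, ω (n + 1)) :=
      Kernel.map_frestrictLe_trajMeasure_compProd_eq_map_trajMeasure
    have hm : Measurable fun ω : ℕ → Step S A E =>
        ((Preorder.frestrictLe n ω : Finset.Iic n → Step S A E), ω (n + 1)) := by fun_prop
    have : IsProbabilityMeasure
        ((M.lawV π s).map (Preorder.frestrictLe (π := fun _ => Step S A E) n)) :=
      Measure.isProbabilityMeasure_map (by fun_prop)
    calc ∫ ω, f (history (n + 1) ω) (ω (n + 1)) ∂M.lawV π s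
        = ∫ p, g p ∂(M.lawV π s).map fun ω => (Preorder.frestrictLe n ω, ω (n + 1)) :=
          (integral_map (f := g) hm.aemeasurable Integrable.of_finite.1).symm
      _ = ∫ x, ∫ y, g (x, y) ∂M.stepKernel π s n x
            ∂(M.lawV π s).map (Preorder.frestrictLe n) := by
          rw [← hmap, Measure.integral_compProd Integrable.of_finite]
      _ = _ := integral_map (f := fun x => ∫ y, g (x, y) ∂M.stepKernel π s n x) (by fun_prop)
          Integrable.of_finite.1

end LMDP

theorem Matrix.integral_mulVec {Ω : Type*} [MeasurableSpace Ω] {μ : Measure Ω} {d : ℕ}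
    (G : Matrix (Fin d) (Fin d) ℝ) {X : Ω → Fin d → ℝ} (hX : Integrable X μ) :
    ∫ ω, G.mulVec (X ω) ∂μ = G.mulVec (∫ ω, X ω ∂μ) :=
  (LinearMap.toContinuousLinearMap G.mulVecLin).integral_comp_comm hX

/-! ### The performance difference lemma -/

namespace LMDP

variable {S A E : Type*} {d : ℕ} (M : LMDP S A E d)

/-- The expected return of taking action `a` in state `s` and receiving `V` at the next state. -/
noncomputable def lookahead (V : S → Fin d → ℝ) (s : S) (a : A) : Fin d → ℝ :=
  ∫ x, (M.reward x.event + (M.mult x.event).mulVec (V x.next)) ∂(M.stepLaw s a).toMeasure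

/-- The expected gain over `V` of one step of `π` after the history `h`, with continuation
value `V`. -/
noncomputable def advantage (π : Policy S A E) (V : S → Fin d → ℝ) (s : S) {n : ℕ}
    (h : Fin n → Step S A E) : Fin d → ℝ :=
  ∫ x, (M.reward x.event + (M.mult x.event).mulVec (V x.next)) ∂(M.policyStep π s h).toMeasure
    - V (currentState s h)

theorem advantage_eq_sum [Finite S] [Fintype A] [Finite E] (π : Policy S A E)
    (V : S → Fin d → ℝ) (s : S) {n : ℕ} (h : Fin n → Step S A E) :
    M.advantage π V s h = ∑ a, (π n s h a).toReal •
      (M.lookahead V (currentState s h) a - V (currentState s h)) := by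
  simp only [smul_sub, Finset.sum_sub_distrib, ← Finset.sum_smul, PMF.sum_toReal, one_smul]
  exact congrArg (· - _) (PMF.integral_bind_eq_sum _ _ _)

theorem advantage_stationary (f : S → A) (V : S → Fin d → ℝ) (s : S) {n : ℕ}
    (h : Fin n → Step S A E) :
    M.advantage (Policy.stationary E f) V s h =
      M.lookahead V (currentState s h) (f (currentState s h)) - V (currentState s h) := by
  rw [advantage, policyStep_stationary, lookahead]

theorem advantage_withFirst_zero (π : Policy S A E) (V : S → Fin d → ℝ) (s : S) (a : A)
    (h : Fin 0 → Step S A E) :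
    M.advantage (π.withFirst a) V s h = M.lookahead V s a - V s := by
  rw [advantage, policyStep_withFirst, lookahead]
  rfl

theorem discountedReward_eq (ω : ℕ → Step S A E) (t : ℕ) :
    M.discountedReward (fun t => (ω t).event) t =
      (M.historyDiscount (history t ω)).mulVec (M.reward (ω t).event) := by
  rw [discountedReward, historyDiscount_history]

variable [Finite S] [Finite A] [Finite E]

theorem integrable_lawV_step {F : Type*} [NormedAddCommGroup F] (π : Policy S A E) (s : S) (n : ℕ)
    (f : (Fin n → Step S A E) → Step S A E → F) :
    Integrable (fun ω => f (history n ω) (ω n)) (M.lawV π s) :=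
  integrable_comp_of_finite (fun p : (Fin n → Step S A E) × Step S A E => f p.1 p.2)
    ((measurable_history n).prodMk (measurable_pi_apply n))

theorem integrable_discountedReward (π : Policy S A E) (s : S) (t : ℕ) :
    Integrable (fun ω => M.discountedReward (fun t => (ω t).event) t) (M.lawV π s) := by
  simp only [discountedReward_eq]
  exact M.integrable_lawV_step π s t fun h x => (M.historyDiscount h).mulVec (M.reward x.event)

theorem integrable_trajReturn_lawV (hM : M.DiagonalDiscount) (π : Policy S A E) (s : S) :
    Integrable M.trajReturn (M.lawV π s) := by
  obtain ⟨C, ρ, hρ0, hρ1, h⟩ := M.exists_norm_discountedReward_le hM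
  have hmeas : AEStronglyMeasurable M.trajReturn (M.lawV π s) := by
    refine aestronglyMeasurable_of_tendsto_ae Filter.atTop
      (f := fun n ω => ∑ t ∈ Finset.range n, M.discountedReward (fun t => (ω t).event) t)
      (fun n => ?_) (ae_of_all _ fun ω => ?_)
    · exact (integrable_finsetSum _ fun t _ => M.integrable_discountedReward π s t).1
    · exact (M.summable_discountedReward hM _).hasSum.tendsto_sum_nat
  have hbound : ∀ ω, ‖M.trajReturn ω‖ ≤ C * (1 - ρ)⁻¹ := fun ω =>
    tsum_of_norm_bounded ((hasSum_geometric_of_lt_one hρ0 hρ1).mul_left C) (h _)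
  exact Integrable.of_bound hmeas _ (ae_of_all _ hbound)

theorem hasSum_value (hM : M.DiagonalDiscount) (π : Policy S A E) (s : S) :
    HasSum (fun t => ∫ ω, M.discountedReward (fun t => (ω t).event) t ∂M.lawV π s)
      (M.value π s) := by
  obtain ⟨C, ρ, hρ0, hρ1, h⟩ := M.exists_norm_discountedReward_le hM
  refine hasSum_integral_of_summable_integral_norm (M.integrable_discountedReward π s) ?_
  refine Summable.of_nonneg_of_le (fun t => integral_nonneg fun ω => norm_nonneg _) (fun t => ?_)
    ((summable_geometric_of_lt_one hρ0 hρ1).mul_left C)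
  refine (integral_mono (M.integrable_discountedReward π s t).norm (integrable_const _)
    fun ω => h _ t).trans_eq ?_
  simp

/-- The performance difference lemma: the value of `π` exceeds `V` by the expected discounted sum
of the advantages of `π` over `V`. -/
theorem hasSum_value_sub (hM : M.DiagonalDiscount) (π : Policy S A E) (V : S → Fin d → ℝ) (s : S) :
    HasSum (fun t => ∫ ω, (M.historyDiscount (history t ω)).mulVec
      (M.advantage π V s (history t ω)) ∂M.lawV π s) (M.value π s - V s) := by
  let a : ℕ → Fin d → ℝ := fun t => ∫ ω, (M.historyDiscount (history t ω)).mulVec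
    (V (currentState s (history t ω))) ∂M.lawV π s
  have ha0 : a 0 = V s := by
    have : ∀ ω : ℕ → Step S A E, (M.historyDiscount (history 0 ω)).mulVec
        (V (currentState s (history 0 ω))) = V s := fun ω => Matrix.one_mulVec _
    simp only [a, this, integral_const, probReal_univ, one_smul]
  have ha : Summable a := by
    obtain ⟨C, ρ, hC, hρ0, hρ1, h⟩ := M.exists_norm_discount_mulVec_le hM
    obtain ⟨R, hR⟩ : ∃ R, ∀ s, ‖V s‖ ≤ R :=
      (Filter.eventually_all.2 fun s => Filter.eventually_ge_atTop ‖V s‖).exists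
    refine Summable.of_norm_bounded ((summable_geometric_of_lt_one hρ0 hρ1).mul_left (C * R))
      fun t => ?_
    refine (norm_integral_le_of_norm_le_const (C := C * R * ρ ^ t)
      (ae_of_all _ fun ω => ?_)).trans_eq (by simp)
    rw [historyDiscount_history]
    refine (h _ t _).trans ?_
    gcongr
    exact hR _
  -- The advantage at time `t` is averaged over step `t`; undoing this conditioning leaves the
  -- discounted reward plus a telescoping difference of discounted values of `V`.
  have hterm : ∀ t, ∫ ω, (M.historyDiscount (history t ω)).mulVec
      (M.advantage π V s (history t ω)) ∂M.lawV π s =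
      ∫ ω, M.discountedReward (fun t => (ω t).event) t ∂M.lawV π s + (a (t + 1) - a t) := by
    intro t
    let g : (Fin t → Step S A E) → Step S A E → Fin d → ℝ := fun h x =>
      (M.historyDiscount h).mulVec (M.reward x.event + (M.mult x.event).mulVec (V x.next))
    have h1 : ∀ h : Fin t → Step S A E, (M.historyDiscount h).mulVec (M.advantage π V s h) =
        ∫ x, g h x ∂(M.policyStep π s h).toMeasure -
          (M.historyDiscount h).mulVec (V (currentState s h)) := by
      intro h
      rw [advantage, Matrix.mulVec_sub, Matrix.integral_mulVec _ Integrable.of_finite]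
    have h2 : ∀ ω : ℕ → Step S A E, g (history t ω) (ω t) =
        M.discountedReward (fun t => (ω t).event) t +
          (M.historyDiscount (history (t + 1) ω)).mulVec
            (V (currentState s (history (t + 1) ω))) := by
      intro ω
      rw [discountedReward_eq, currentState_history_succ]
      simp only [g, Matrix.mulVec_add, Matrix.mulVec_mulVec]
      rfl
    simp only [h1]
    rw [integral_sub
      (integrable_comp_of_finite
        (fun h => ∫ x, g h x ∂(M.policyStep π s h).toMeasure) (measurable_history t))
      (integrable_comp_of_finite
        (fun h => (M.historyDiscount h).mulVec (V (currentState s h))) (measurable_history t)),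
      ← integral_lawV_step]
    simp only [h2]
    rw [integral_add (M.integrable_discountedReward π s t)
      (integrable_comp_of_finite
        (fun h => (M.historyDiscount h).mulVec (V (currentState s h)))
        (measurable_history (t + 1))), add_sub_assoc]
  simp only [hterm]
  -- The differences `a (t + 1) - a t` sum to `-a 0 = -V s`.
  have hshift : HasSum (fun t => a (t + 1)) (∑' t, a t - V s) := by
    simpa [ha0] using (hasSum_nat_add_iff' 1).2 ha.hasSum
  convert (M.hasSum_value hM π s).add (hshift.sub ha.hasSum) using 1
  abel

theorem qValue_eq_value_withFirst (π : Policy S A E) (s : S) (a : A) :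
    M.qValue π s a = M.value (π.withFirst a) s := by
  rw [qValue, value, lawQ_eq_lawV_withFirst]

theorem hasSum_qValue_sub (hM : M.DiagonalDiscount) (π : Policy S A E) (V : S → Fin d → ℝ)
    (s : S) (a : A) :
    HasSum (fun t => ∫ ω, (M.historyDiscount (history (t + 1) ω)).mulVec
      (M.advantage π V s (history (t + 1) ω)) ∂M.lawQ π s a)
      (M.qValue π s a - M.lookahead V s a) := by
  -- The term at time 0 is the gain `lookahead V s a - V s` of the imposed action; removing it
  -- replaces `V s` by the lookahead.
  have h := (hasSum_nat_add_iff' 1).2 (M.hasSum_value_sub hM (π.withFirst a) V s)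
  have h0 : ∀ ω : ℕ → Step S A E, (M.historyDiscount (history 0 ω)).mulVec
      (M.advantage (π.withFirst a) V s (history 0 ω)) = M.lookahead V s a - V s := fun ω =>
    (Matrix.one_mulVec _).trans (M.advantage_withFirst_zero π V s a _)
  simp only [Finset.sum_range_one, h0, integral_const, probReal_univ, one_smul,
    sub_sub_sub_cancel_right] at h
  rw [qValue_eq_value_withFirst, lawQ_eq_lawV_withFirst]
  exact h

/-! ### Comparing values through the sign of the advantages -/

theorem lexNonneg_neg_advantage {V : S → Fin d → ℝ}
    (hV : ∀ s a, toLex (M.lookahead V s a) ≤ toLex (V s)) (π : Policy S A E) (s : S) {n : ℕ}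
    (h : Fin n → Step S A E) : LexNonneg (-M.advantage π V s h) := by
  have := Fintype.ofFinite A
  rw [advantage_eq_sum, ← Finset.sum_neg_distrib]
  refine LexNonneg.sum fun a => ?_
  rw [← smul_neg, neg_sub]
  exact (toLex_le_toLex_iff_lexNonneg.1 (hV _ a)).smul ENNReal.toReal_nonneg

theorem lexNonneg_integral_discount_mulVec {n : ℕ} {X : (Fin n → Step S A E) → Fin d → ℝ}
    (hX : ∀ h, LexNonneg (X h)) (π : Policy S A E) (s : S) :
    LexNonneg (∫ ω, (M.historyDiscount (history n ω)).mulVec (X (history n ω)) ∂M.lawV π s) :=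
  LexNonneg.integral
    (integrable_comp_of_finite (fun h => (M.historyDiscount h).mulVec (X h))
      (measurable_history n))
    fun _ => (hX _).historyDiscount_mulVec M _

theorem value_le (hM : M.DiagonalDiscount) {V : S → Fin d → ℝ}
    (hV : ∀ s a, toLex (M.lookahead V s a) ≤ toLex (V s)) (π : Policy S A E) (s : S) :
    toLex (M.value π s) ≤ toLex (V s) := by
  rw [toLex_le_toLex_iff_lexNonneg, ← neg_sub]
  refine LexNonneg.of_hasSum (M.hasSum_value_sub hM π V s).neg fun t => ?_
  simp only [← integral_neg, ← Matrix.mulVec_neg]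
  exact M.lexNonneg_integral_discount_mulVec (M.lexNonneg_neg_advantage hV π s) π s

theorem qValue_le (hM : M.DiagonalDiscount) {V : S → Fin d → ℝ}
    (hV : ∀ s a, toLex (M.lookahead V s a) ≤ toLex (V s)) (π : Policy S A E) (s : S) (a : A) :
    toLex (M.qValue π s a) ≤ toLex (M.lookahead V s a) := by
  rw [toLex_le_toLex_iff_lexNonneg, ← neg_sub]
  refine LexNonneg.of_hasSum (M.hasSum_qValue_sub hM π V s a).neg fun t => ?_
  simp only [← integral_neg, ← Matrix.mulVec_neg, lawQ_eq_lawV_withFirst]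
  exact M.lexNonneg_integral_discount_mulVec (M.lexNonneg_neg_advantage hV π s) _ s

theorem le_value_stationary (hM : M.DiagonalDiscount) {V : S → Fin d → ℝ} {f : S → A}
    (hV : ∀ s, toLex (V s) ≤ toLex (M.lookahead V s (f s))) (s : S) :
    toLex (V s) ≤ toLex (M.value (Policy.stationary E f) s) := by
  rw [toLex_le_toLex_iff_lexNonneg]
  refine LexNonneg.of_hasSum (M.hasSum_value_sub hM _ V s) fun t => ?_
  refine M.lexNonneg_integral_discount_mulVec (fun h => ?_) _ s
  rw [advantage_stationary]
  exact toLex_le_toLex_iff_lexNonneg.1 (hV _)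

theorem value_stationary_eq (hM : M.DiagonalDiscount) {V : S → Fin d → ℝ} {f : S → A}
    (hV : ∀ s, M.lookahead V s (f s) = V s) (s : S) :
    M.value (Policy.stationary E f) s = V s := by
  have h := M.hasSum_value_sub hM (Policy.stationary E f) V s
  simp only [advantage_stationary, hV, sub_self, Matrix.mulVec_zero, integral_zero] at h
  exact sub_eq_zero.1 (h.unique hasSum_zero)

theorem qValue_stationary_eq (hM : M.DiagonalDiscount) {V : S → Fin d → ℝ} {f : S → A}
    (hV : ∀ s, M.lookahead V s (f s) = V s) (s : S) (a : A) :
    M.qValue (Policy.stationary E f) s a = M.lookahead V s a := by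
  have h := M.hasSum_qValue_sub hM (Policy.stationary E f) V s a
  simp only [advantage_stationary, hV, sub_self, Matrix.mulVec_zero, integral_zero] at h
  exact sub_eq_zero.1 (h.unique hasSum_zero)

/-! ### Policy evaluation and the Bellman optimality equation -/

/-- The expected discounted continuation value of the stationary policy `f`, as a linear map. -/
noncomputable def continuation (f : S → A) : (S → Fin d → ℝ) →ₗ[ℝ] (S → Fin d → ℝ) where
  toFun W s := ∫ x, (M.mult x.event).mulVec (W x.next) ∂(M.stepLaw s (f s)).toMeasure
  map_add' W W' := by
    funext s
    simp only [Pi.add_apply, Matrix.mulVec_add]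
    exact integral_add Integrable.of_finite Integrable.of_finite
  map_smul' c W := by
    funext s
    simp only [Pi.smul_apply, Matrix.mulVec_smul, RingHom.id_apply]
    exact integral_smul _ _

/-- Each application of the fixed-point equation gains a factor `ρ` in the weighted bound on `W`. -/
theorem eq_zero_of_continuation_eq (hM : M.DiagonalDiscount) {f : S → A} {W : S → Fin d → ℝ}
    (hW : M.continuation f W = W) : W = 0 := by
  obtain ⟨w, ρ, hw, hρ0, hρ1, h⟩ := M.exists_contraction_weights hM
  obtain ⟨R, hR0, hR⟩ : ∃ R, 0 ≤ R ∧ ∀ s, ‖W s‖ ≤ R :=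
    ((Filter.eventually_ge_atTop 0).and
      (Filter.eventually_all.2 fun s => Filter.eventually_ge_atTop ‖W s‖)).exists
  have hbound : ∀ n : ℕ, ∀ s i, |W s i| ≤ R * ρ ^ n * w i := by
    intro n
    induction n with
    | zero =>
      intro s i
      rw [pow_zero, mul_one]
      exact ((norm_le_pi_norm (W s) i).trans (hR s)).trans (le_mul_of_one_le_right hR0 (hw i))
    | succ n ih =>
      intro s i
      have hterm : ∀ x : Step S A E, |(M.mult x.event).mulVec (W x.next) i| ≤
          R * ρ ^ (n + 1) * w i := fun x =>
        (abs_mulVec_le_of_sum_abs_le (by positivity) (ih x.next) (h x.event i)).trans_eq (by ring)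
      have heq : W s i = ∫ x, (M.mult x.event).mulVec (W x.next) i
          ∂(M.stepLaw s (f s)).toMeasure :=
        (congrFun (congrFun hW.symm s) i).trans (eval_integral (fun _ => Integrable.of_finite) i)
      rw [heq, ← Real.norm_eq_abs]
      refine (norm_integral_le_of_norm_le_const (C := R * ρ ^ (n + 1) * w i)
        (ae_of_all _ hterm)).trans_eq ?_
      rw [probReal_univ, mul_one]
  funext s i
  have hlim : Filter.Tendsto (fun n : ℕ => R * ρ ^ n * w i) Filter.atTop (nhds 0) := by
    simpa using ((tendsto_pow_atTop_nhds_zero_of_lt_one hρ0 hρ1).const_mul R).mul_const (w i)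
  exact abs_nonpos_iff.1 (ge_of_tendsto' hlim fun n => hbound n s i)

/-- The equation is linear: identity minus continuation is injective on a finite-dimensional space,
hence surjective, and so attains the expected immediate reward. -/
theorem exists_lookahead_eq (hM : M.DiagonalDiscount) (f : S → A) :
    ∃ W : S → Fin d → ℝ, ∀ s, M.lookahead W s (f s) = W s := by
  have hinj : Function.Injective
      (LinearMap.id - M.continuation f : (S → Fin d → ℝ) →ₗ[ℝ] (S → Fin d → ℝ)) := by
    rw [← LinearMap.ker_eq_bot, LinearMap.ker_eq_bot']
    intro W hW
    exact M.eq_zero_of_continuation_eq hM (sub_eq_zero.1 hW).symm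
  obtain ⟨W, hW⟩ := LinearMap.injective_iff_surjective.1 hinj fun s =>
    ∫ x, M.reward x.event ∂(M.stepLaw s (f s)).toMeasure
  refine ⟨W, fun s => ?_⟩
  rw [lookahead, integral_add Integrable.of_finite Integrable.of_finite]
  exact (eq_add_of_sub_eq (congrFun hW s)).symm

/-- A solution of the evaluation equation must be the value, so the value satisfies it; no Markov
property of the shifted trajectory is needed. -/
theorem lookahead_value_stationary (hM : M.DiagonalDiscount) (f : S → A) (s : S) :
    M.lookahead (M.value (Policy.stationary E f)) s (f s) =
      M.value (Policy.stationary E f) s := by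
  obtain ⟨W, hW⟩ := M.exists_lookahead_eq hM f
  rw [funext (M.value_stationary_eq hM hW)]
  exact hW s

/-- The lexicographic Bellman optimality equation has a solution. -/
theorem exists_bellman_optimal [Nonempty A] (hM : M.DiagonalDiscount) :
    ∃ (V : S → Fin d → ℝ) (f : S → A), (∀ s a, toLex (M.lookahead V s a) ≤ toLex (V s)) ∧
      ∀ s, M.lookahead V s (f s) = V s := by
  -- Maximal in the statewise partial order, which is all that finiteness gives directly; the greedy
  -- `g` is at least as good in every state, so maximality forces equality.
  obtain ⟨f, -, hf⟩ := Set.finite_univ.exists_maximalFor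
    (fun (f : S → A) (s : S) => toLex (M.value (Policy.stationary E f) s)) Set.univ
    Set.univ_nonempty
  set V := M.value (Policy.stationary E f) with hV
  choose g hg using fun s => Finite.exists_max fun a => toLex (M.lookahead V s a)
  have himp : ∀ s, toLex (V s) ≤ toLex (M.value (Policy.stationary E g) s) :=
    M.le_value_stationary hM fun s =>
      (congrArg toLex (M.lookahead_value_stationary hM f s)).ge.trans (hg s (f s))
  have heq : M.value (Policy.stationary E g) = V := funext fun s =>
    toLex.injective (le_antisymm (hf (Set.mem_univ g) himp s) (himp s))
  have hgV : ∀ s, M.lookahead V s (g s) = V s := fun s => by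
    simpa only [heq] using M.lookahead_value_stationary hM g s
  exact ⟨V, g, fun s a => (hg s a).trans_eq (congrArg toLex (hgV s)), hgV⟩

end LMDP

theorem mainTheorem6 {S A E : Type*} [Finite S] [Finite A] [Nonempty A] [Finite E] {d : ℕ}
    (M : LMDP S A E d) (hM : M.DiagonalDiscount) :
    -- returns and expected returns are well defined
    ((∀ e : ℕ → E, Summable (M.discountedReward e)) ∧
      ∀ π : Policy S A E, (∀ s a, Integrable M.trajReturn (M.lawQ π s a)) ∧
        ∀ s, Integrable M.trajReturn (M.lawV π s)) ∧
    -- the optimal `Q`-value function exists; there is a stationary deterministic uniformly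
    -- optimal policy; every lexicographically greedy one is such
    ∃ Qstar : S → A → Fin d → ℝ, M.IsOptimalQ Qstar ∧
      (∃ f : S → A, M.IsUniformlyOptimal (Policy.stationary E f) ∧
        M.IsOptimalFromEveryState (Policy.stationary E f)) ∧
      ∀ f : S → A, (∀ s, f s ∈ lexArgmax (Qstar s)) →
        M.IsUniformlyOptimal (Policy.stationary E f) ∧
        M.IsOptimalFromEveryState (Policy.stationary E f) := by
  obtain ⟨V, f₀, hV, hf₀⟩ := M.exists_bellman_optimal hM
  have hopt : ∀ f : S → A, (∀ s, M.lookahead V s (f s) = V s) →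
      M.IsUniformlyOptimal (Policy.stationary E f) ∧
        M.IsOptimalFromEveryState (Policy.stationary E f) := by
    refine fun f hf => ⟨fun s a => ⟨⟨_, rfl⟩, ?_⟩, fun π s => ?_⟩
    · rintro _ ⟨π, rfl⟩
      exact (M.qValue_le hM hV π s a).trans_eq
        (congrArg toLex (M.qValue_stationary_eq hM hf s a).symm)
    · exact (M.value_le hM hV π s).trans_eq
        (congrArg toLex (M.value_stationary_eq hM hf s).symm)
  refine ⟨⟨M.summable_discountedReward hM, fun π => ⟨fun s a => ?_, fun s =>
    M.integrable_trajReturn_lawV hM π s⟩⟩, M.lookahead V, ?_, ⟨f₀, hopt f₀ hf₀⟩, fun f hf =>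
    hopt f fun s => toLex.injective (le_antisymm (hV s (f s)) ?_)⟩
  · rw [LMDP.lawQ_eq_lawV_withFirst]
    exact M.integrable_trajReturn_lawV hM _ s
  · have hq : M.qValue (Policy.stationary E f₀) = M.lookahead V :=
      funext fun s => funext fun a => M.qValue_stationary_eq hM hf₀ s a
    exact hq ▸ (hopt f₀ hf₀).1
  -- An action greedy for $Q^\star$ does at least as well as `f₀ s`, whose lookahead is already `V
  -- s`.
  · exact (congrArg toLex (hf₀ s)).ge.trans (hf s (f₀ s))
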